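/- Let $\lambda\in\mathbb{R}$, $\delta>0$ and $\alpha>|\beta|\ge 0$. Let $K_\nu(x)=\int_0^\infty e^{-x\cosh t}\cosh(\nu t)\,dt$ $(x>0)$ be the modified Bessel function of the second kind, and let $GH(\lambda,\alpha,\beta,\delta,0)$ be the generalized hyperbolic distribution on $\mathbb{R}$ with density $$p(x)=\frac{(\alpha^2-\beta^2)^{\lambda/2}}{\sqrt{2\pi}\,\alpha^{\lambda-\frac12}\delta^{\lambda}K_{\lambda}\big(\delta\sqrt{\alpha^2-\beta^2}\big)}\,e^{\beta x}\,(\delta^2+x^2)^{(\lambda-\frac12)/2}\,K_{\lambda-\frac12}\big(\alpha\sqrt{\delta^2+x^2}\big),\qquad x\in\mathbb{R}.$$ For $x\neq0$ put $$\mathcal{A}_{\lambda,\alpha,\beta,\delta}f(x)=\frac{x^2+\delta^2}{x}f''(x)+\Big[2\lambda+2\beta x+\frac{2\beta\delta^2}{x}-\frac{\delta^2}{x^2}\Big]f'(x)+\Big[2\lambda\beta-(\alpha^2-\beta^2)x+\frac{\beta^2\delta^2}{x}-\frac{\beta\delta^2}{x^2}\Big]f(x).$$ Call $f:\mathbb{R}\to\mathbb{R}$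 piecewise twice continuously differentiable if $f$ is $C^1$ on $\mathbb{R}$ and is $C^2$ away from a finite set of break points, at which $f''$ has finite one-sided limits ($f''$ is read as $0$ at points where it does not exist). Let $W$ be a real-valued random variable. Then $W$ follows the $GH(\lambda,\alpha,\beta,\delta,0)$ distribution if and only if $\mathbb{P}(W=0)=0$ (so that $\mathcal{A}_{\lambda,\alpha,\beta,\delta}f(W)$ is almost surely defined) and $$\mathbb{E}\big[\mathcal{A}_{\lambda,\alpha,\beta,\delta}f(W)\big]=0$$ (the expectation existing) for every piecewise twice continuously differentiable $f:\mathbb{R}\to\mathbb{R}$ that is twice continuously differentiable in a neighbourhood of $0$, satisfies $\mathbb{E}|\mathcal{A}_{\lambda,\alpha,\beta,\delta}f(Z)|<\infty$ for $Z\sim GH(\lambda,\alpha,\beta,\delta,0)$, and satisfies $$\lim_{|x|\to\infty}|x|^{\lambda}e^{-\alpha|x|+\beta x}f^{(k)}(x)=0\qquad\text{for }k=0,1,2.$$ -/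

import Mathlib

open MeasureTheory Filter Topology

noncomputable section

/-- The modified Bessel function of the second kind of real order `ν`,
`K_ν(x) = ∫₀^∞ exp(-x cosh t) cosh(ν t) dt`, for `x > 0`. -/
def besselK (ν x : ℝ) : ℝ :=
  ∫ t in Set.Ioi (0 : ℝ), Real.exp (-x * Real.cosh t) * Real.cosh (ν * t)

/-- The density of the generalized hyperbolic distribution `GH(lam, α, β, δ, μ)`. -/
def ghPDF (lam α β δ μ x : ℝ) : ℝ :=
  (α ^ 2 - β ^ 2) ^ (lam / 2) /
      (Real.sqrt (2 * Real.pi) * α ^ (lam - 1 / 2) * δ ^ lam *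
        besselK lam (δ * Real.sqrt (α ^ 2 - β ^ 2))) *
    Real.exp (β * (x - μ)) *
    (δ ^ 2 + (x - μ) ^ 2) ^ ((lam - 1 / 2) / 2) *
    besselK (lam - 1 / 2) (α * Real.sqrt (δ ^ 2 + (x - μ) ^ 2))

/-- The generalized hyperbolic distribution `GH(lam, α, β, δ, μ)`, as a measure on `ℝ`. -/
def ghMeasure (lam α β δ μ : ℝ) : Measure ℝ :=
  volume.withDensity fun x => ENNReal.ofReal (ghPDF lam α β δ μ x)

/-- The second-order Stein operator of `GH(lam, α, β, δ, 0)`. It is meaningful at points `x ≠ 0`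
at which `f` is twice differentiable; other points only get a conventional value. -/
def ghStein (lam α β δ : ℝ) (f : ℝ → ℝ) (x : ℝ) : ℝ :=
  (x ^ 2 + δ ^ 2) / x * deriv (deriv f) x +
    (2 * lam + 2 * β * x + 2 * β * δ ^ 2 / x - δ ^ 2 / x ^ 2) * deriv f x +
    (2 * lam * β - (α ^ 2 - β ^ 2) * x + β ^ 2 * δ ^ 2 / x - β * δ ^ 2 / x ^ 2) * f x

/-- Piecewise twice continuously differentiable functions: `f` is continuously differentiable,
and twice continuously differentiable away from finitely many points, at which `f''` has finite
one-sided limits. -/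
def PiecewiseC2 (f : ℝ → ℝ) : Prop :=
  ContDiff ℝ 1 f ∧
    ∃ S : Finset ℝ, (∀ x, x ∉ S → ContDiffAt ℝ 2 f x) ∧
      ∀ s ∈ S, (∃ l, Tendsto (deriv (deriv f)) (𝓝[<] s) (𝓝 l)) ∧
        (∃ r, Tendsto (deriv (deriv f)) (𝓝[>] s) (𝓝 r))

/-- The class of test functions: piecewise twice continuously differentiable functions, with no
break at the singular point `0` of the operator, such that `E|A f(Z)| < ∞` for
`Z ∼ GH(lam, α, β, δ, 0)` and `|x|^lam exp(-α|x| + βx) f⁽ᵏ⁾(x) → 0` as `|x| → ∞`, `k = 0, 1, 2`. -/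
structure IsGHTestFunction (lam α β δ : ℝ) (f : ℝ → ℝ) : Prop where
  piecewiseC2 : PiecewiseC2 f
  contDiffAt_zero : ContDiffAt ℝ 2 f 0
  integrable : Integrable (ghStein lam α β δ f) (ghMeasure lam α β δ 0)
  decay : ∀ k ≤ 2, Tendsto
    (fun x : ℝ => |x| ^ lam * Real.exp (-α * |x| + β * x) * iteratedDeriv k f x)
    (cocompact ℝ) (𝓝 0)

end

/-! Write G_a(z) = ∫_0^∞ y^(a-1) exp(-(z/y + ψy)/2) dy. Up to an explicit power this is a Bessel K
function of √(zψ), and the density is a constant times e^{βx} G_ν(x² + δ²), with ν = lam - 1/2 and ψ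
= α². Two identities replace Bessel calculus: G_a' = -G_{a-1}/2 and ψ G_{a+1} = 2a G_a + z G_{a-1}.

With g = e^{βx} f, u = g'/x and z = x² + δ², they give an exact derivative: the flux Φ = z G_ν(z) u
+ α² G_{ν+1}(z) g satisfies Φ' = G_ν(z) e^{βx} A f, a constant times density times Stein operator
(`ghFlux_hasDerivAt_stein`).

Necessity: the decay condition makes Φ vanish at ±∞, so Φ' integrates to zero once Φ is continuous.
The only obstacle is x = 0, where u may blow up; integrability of Φ' forces g'(0) = 0, and u then
extends continuously (`integral_ghStein_eq_zero`).

Sufficiency: for a continuous compactly supported h of mean zero under GH, the primitive Φ of G_ν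
e^{βx} h has compact support. Prescribing the flux Φ is a first-order linear equation for g, with
homogeneous solution z^(-ν) G_ν(z); variation of constants gives a smooth enough g of polynomial
growth, hence an admissible f with A f = h off 0 (`exists_isGHTestFunction_ghStein_eq`). So the law
of W annihilates every such h, and must equal GH (`eq_of_forall_integral_eq_zero`). -/

/-! ### The generalized inverse Gaussian integral: integrability, derivative, recurrence -/

/-- The normalizing integral of the generalized inverse Gaussian distribution. -/
noncomputable def gigIntegral (a ψ z : ℝ) : ℝ :=
  ∫ y in Set.Ioi (0 : ℝ), y ^ (a - 1) * Real.exp (-(z / y + ψ * y) / 2)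

theorem Real.exp_neg_div_le {z y : ℝ} (hz : 0 < z) (hy : 0 < y) (n : ℕ) :
    Real.exp (-(z / y) / 2) ≤ n.factorial * (2 / z) ^ n * y ^ n := by
  have h := Real.pow_div_factorial_le_exp (x := z / y / 2) (by positivity) n
  have hf : (0 : ℝ) < n.factorial := by positivity
  rw [neg_div, Real.exp_neg, inv_le_comm₀ (Real.exp_pos _) (by positivity)]
  refine le_trans (le_of_eq ?_) h
  simp only [div_pow]
  field_simp

/-- Near 0 the factor exp(-z/(2y)) beats every negative power of y. Trading it for y^n, with n large
enough that a + n > 0, leaves a Gamma integrand. -/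
theorem gig_integrand_le (a ψ : ℝ) {z : ℝ} (hz : 0 < z) :
    ∃ n : ℕ, 0 < a + n ∧ ∃ C : ℝ, ∀ y : ℝ, 0 < y →
      y ^ (a - 1) * Real.exp (-(z / y + ψ * y) / 2) ≤
        C * (y ^ (a + n - 1) * Real.exp (-(ψ / 2 * y))) := by
  obtain ⟨n, hn⟩ := exists_nat_gt (-a)
  refine ⟨n, by linarith, n.factorial * (2 / z) ^ n, fun y hy => ?_⟩
  have e : Real.exp (-(z / y + ψ * y) / 2) =
      Real.exp (-(z / y) / 2) * Real.exp (-(ψ / 2 * y)) := by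
    rw [← Real.exp_add]; ring_nf
  have e2 : y ^ (a + n - 1) = y ^ (a - 1) * y ^ n := by
    rw [← Real.rpow_natCast, ← Real.rpow_add hy]; ring_nf
  rw [e, e2]
  have := mul_le_mul_of_nonneg_left (Real.exp_neg_div_le hz hy n)
    (by positivity : 0 ≤ y ^ (a - 1) * Real.exp (-(ψ / 2 * y)))
  calc _ = _ := by ring
    _ ≤ _ := this
    _ = _ := by ring

theorem gig_integrand_continuousOn (a ψ z : ℝ) :
    ContinuousOn (fun y : ℝ => y ^ (a - 1) * Real.exp (-(z / y + ψ * y) / 2)) (Set.Ioi 0) := by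
  intro y hy
  have hy : y ≠ 0 := ne_of_gt hy
  apply ContinuousAt.continuousWithinAt
  fun_prop (disch := first | assumption | exact Or.inl hy)

theorem gig_integrableOn (a : ℝ) {ψ z : ℝ} (hψ : 0 < ψ) (hz : 0 < z) :
    IntegrableOn (fun y : ℝ => y ^ (a - 1) * Real.exp (-(z / y + ψ * y) / 2)) (Set.Ioi 0) := by
  obtain ⟨n, hn, C, hC⟩ := gig_integrand_le a ψ hz
  have h1 : IntegrableOn (fun y : ℝ => y ^ (a + n - 1) * Real.exp (-(ψ / 2 * y))) (Set.Ioi 0) := by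
    have := integrableOn_rpow_mul_exp_neg_mul_rpow (p := 1) (s := a + n - 1) (b := ψ / 2)
      (by linarith) one_pos (by positivity)
    simpa using this
  refine Integrable.mono' (h1.const_mul C)
    ((gig_integrand_continuousOn a ψ z).aestronglyMeasurable measurableSet_Ioi) ?_
  filter_upwards [ae_restrict_mem measurableSet_Ioi] with y hy
  have hy : 0 < y := hy
  rw [Real.norm_of_nonneg (by positivity)]
  exact hC y hy

theorem gigIntegral_pos (a : ℝ) {ψ z : ℝ} (hψ : 0 < ψ) (hz : 0 < z) : 0 < gigIntegral a ψ z := by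
  unfold gigIntegral
  rw [setIntegral_pos_iff_support_of_nonneg_ae _ (gig_integrableOn a hψ hz)]
  · have : Set.Ioi (0 : ℝ) ⊆
        Function.support (fun y : ℝ => y ^ (a - 1) * Real.exp (-(z / y + ψ * y) / 2)) := by
      intro y hy
      have hy : 0 < y := hy
      exact (by positivity : y ^ (a - 1) * Real.exp (-(z / y + ψ * y) / 2) ≠ 0)
    rw [Set.inter_eq_right.2 this]; simp
  · filter_upwards [ae_restrict_mem measurableSet_Ioi] with y hy
    have hy : 0 < y := hy
    simp only [Pi.zero_apply]; positivity

theorem gigIntegral_le (a : ℝ) {ψ z w : ℝ} (hψ : 0 < ψ) (hz : 0 < z) (hzw : z ≤ w) :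
    gigIntegral a ψ w ≤ gigIntegral a ψ z := by
  refine setIntegral_mono_on (gig_integrableOn a hψ (hz.trans_le hzw)) (gig_integrableOn a hψ hz)
    measurableSet_Ioi fun y hy => ?_
  have hy : 0 < y := hy
  gcongr

theorem gigIntegral_hasDerivAt (a : ℝ) {ψ z : ℝ} (hψ : 0 < ψ) (hz : 0 < z) :
    HasDerivAt (gigIntegral a ψ) (-(gigIntegral (a - 1) ψ z) / 2) z := by
  have key := hasDerivAt_integral_of_dominated_loc_of_deriv_le
    (μ := volume.restrict (Set.Ioi (0 : ℝ))) (x₀ := z) (s := Set.Ioi (z / 2))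
    (F := fun w y => y ^ (a - 1) * Real.exp (-(w / y + ψ * y) / 2))
    (F' := fun w y => -(y ^ (a - 1 - 1) * Real.exp (-(w / y + ψ * y) / 2)) / 2)
    -- For w > z/2 the factor exp(-w/(2y)) is at most its value at z/2, which is still an integrable
    -- majorant.
    (bound := fun y => (y ^ (a - 1 - 1) * Real.exp (-(z / 2 / y + ψ * y) / 2)) / 2)
    (Ioi_mem_nhds (by linarith))
    (Eventually.of_forall fun w =>
      (gig_integrand_continuousOn a ψ w).aestronglyMeasurable measurableSet_Ioi)
    (gig_integrableOn a hψ hz)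
    (((gig_integrand_continuousOn (a - 1) ψ z).neg.div_const 2).aestronglyMeasurable
      measurableSet_Ioi)
    ?_ ((gig_integrableOn (a - 1) hψ (half_pos hz)).div_const 2) ?_
  · have h := key.2
    rw [integral_div, integral_neg] at h
    exact h
  · filter_upwards [ae_restrict_mem measurableSet_Ioi] with y hy w hw
    have hy : 0 < y := hy
    have hw : z / 2 < w := hw
    rw [norm_div, norm_neg, Real.norm_of_nonneg (by positivity), Real.norm_two]
    gcongr
  · filter_upwards [ae_restrict_mem measurableSet_Ioi] with y hy w _
    have hy : 0 < y := hy
    have h1 : HasDerivAt (fun w : ℝ => -(w / y + ψ * y) / 2) (-(1 / y) / 2) w :=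
      ((((hasDerivAt_id w).div_const y).add_const (ψ * y)).neg).div_const 2
    refine (h1.exp.const_mul (y ^ (a - 1))).congr_deriv ?_
    rw [Real.rpow_sub_one hy.ne' (a - 1)]
    field_simp

/-- Integrate the derivative of y^a exp(-(z/y + ψy)/2) over (0, ∞); both boundary values vanish. -/
theorem gigIntegral_recurrence (a : ℝ) {ψ z : ℝ} (hψ : 0 < ψ) (hz : 0 < z) :
    ψ * gigIntegral (a + 1) ψ z = 2 * a * gigIntegral a ψ z + z * gigIntegral (a - 1) ψ z := by
  have hi0 := gig_integrableOn a hψ hz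
  have hi1 := gig_integrableOn (a + 1) hψ hz
  have hi2 := gig_integrableOn (a - 1) hψ hz
  set F : ℝ → ℝ := fun y => y ^ a * Real.exp (-(z / y + ψ * y) / 2) with hF
  obtain ⟨m, hm⟩ := exists_nat_gt (-a)
  have hbd : ∀ y : ℝ, 0 < y → ‖F y‖ ≤
      (m.factorial * (2 / z) ^ m) * (y ^ (a + m) * Real.exp (-(ψ / 2) * y)) := fun y hy => by
    have h1 := Real.exp_neg_div_le hz hy m
    rw [Real.norm_of_nonneg (by positivity), Real.rpow_add hy, Real.rpow_natCast]
    have e : Real.exp (-(z / y + ψ * y) / 2) =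
        Real.exp (-(z / y) / 2) * Real.exp (-(ψ / 2) * y) := by
      rw [← Real.exp_add]; ring_nf
    simp only [e, hF]
    have := mul_le_mul_of_nonneg_left h1 (by positivity : 0 ≤ y ^ a * Real.exp (-(ψ / 2) * y))
    calc _ = _ := by ring
      _ ≤ _ := this
      _ = _ := by ring
  have hlim0 : Tendsto F (𝓝[>] 0) (𝓝 0) := by
    refine squeeze_zero_norm' (eventually_mem_nhdsWithin.mono fun y hy => hbd y hy) ?_
    have : ContinuousAt (fun y : ℝ => (m.factorial * (2 / z) ^ m) *
        (y ^ (a + m) * Real.exp (-(ψ / 2) * y))) 0 := by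
      have := Real.continuousAt_rpow_const 0 (a + m) (Or.inr (by linarith))
      fun_prop
    have h2 := this.tendsto.mono_left (nhdsWithin_le_nhds (s := Set.Ioi 0))
    simpa [Real.zero_rpow (show a + m ≠ 0 by linarith)] using h2
  have hlimt : Tendsto F atTop (𝓝 0) := by
    refine squeeze_zero_norm' ((eventually_gt_atTop 0).mono fun y hy => hbd y hy) ?_
    simpa using (tendsto_rpow_mul_exp_neg_mul_atTop_nhds_zero (a + m) (ψ / 2) (by positivity)).const_mul
      ((m.factorial : ℝ) * (2 / z) ^ m)
  have hd : ∀ y ∈ Set.Ioi (0 : ℝ), HasDerivAt F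
      (a * (y ^ (a - 1) * Real.exp (-(z / y + ψ * y) / 2)) +
        z / 2 * (y ^ (a - 1 - 1) * Real.exp (-(z / y + ψ * y) / 2)) -
        ψ / 2 * (y ^ (a + 1 - 1) * Real.exp (-(z / y + ψ * y) / 2))) y := by
    intro y hy
    have hy : 0 < y := hy
    have h1 : HasDerivAt (fun y : ℝ => -(z / y + ψ * y) / 2) (-(z * (-(y ^ 2)⁻¹) + ψ * 1) / 2) y :=
      ((((hasDerivAt_inv hy.ne').const_mul z).add ((hasDerivAt_id y).const_mul ψ)).neg).div_const 2
    refine ((Real.hasDerivAt_rpow_const (p := a) (Or.inl hy.ne')).mul h1.exp).congr_deriv ?_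
    rw [Real.rpow_sub_one hy.ne' (a - 1), Real.rpow_sub_one hy.ne' a, add_sub_cancel_right]
    field_simp
    ring
  -- With z / 0 = 0 and 0 ^ 0 = 1, `F 0` equals 1 when a = 0, although the right limit is 0. The
  -- update restores right continuity.
  have := integral_Ioi_of_hasDerivAt_of_tendsto (f := Function.update F 0 0) (a := (0 : ℝ)) (m := 0)
    (f' := fun y => a * (y ^ (a - 1) * Real.exp (-(z / y + ψ * y) / 2)) +
        z / 2 * (y ^ (a - 1 - 1) * Real.exp (-(z / y + ψ * y) / 2)) -
        ψ / 2 * (y ^ (a + 1 - 1) * Real.exp (-(z / y + ψ * y) / 2)))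
    ?_ ?_ ?_ ?_
  · rw [integral_sub, integral_add, integral_const_mul, integral_const_mul,
      integral_const_mul] at this
    · simp only [Function.update_self, sub_zero] at this
      unfold gigIntegral
      linarith
    · exact hi0.const_mul a
    · exact hi2.const_mul _
    · exact (hi0.const_mul a).add (hi2.const_mul _)
    · exact hi1.const_mul _
  · rw [continuousWithinAt_update_same]
    simpa using hlim0
  · intro y hy
    refine (hd y hy).congr_of_eventuallyEq ?_
    filter_upwards [Ioi_mem_nhds (show (0 : ℝ) < y from hy)] with w hw
    exact Function.update_of_ne (ne_of_gt hw) _ _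
  · exact ((hi0.const_mul a).add (hi2.const_mul _)).sub (hi1.const_mul _)
  · refine hlimt.congr' ?_
    filter_upwards [eventually_gt_atTop 0] with w hw
    exact (Function.update_of_ne (ne_of_gt hw) _ _).symm

/-! ### Identification with the Bessel function K -/

/-- The substitution y = √(z/ψ) e^t balances the two terms of the exponent: z/y + ψy = 2√(zψ) cosh
t. -/
theorem gig_integrand_exp (a t : ℝ) {ψ z : ℝ} (hψ : 0 < ψ) (hz : 0 < z) :
    |Real.sqrt (z / ψ) * Real.exp t| • ((Real.sqrt (z / ψ) * Real.exp t) ^ (a - 1) *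
      Real.exp (-(z / (Real.sqrt (z / ψ) * Real.exp t) +
        ψ * (Real.sqrt (z / ψ) * Real.exp t)) / 2)) =
    Real.sqrt (z / ψ) ^ a *
      (Real.exp (-(Real.sqrt (z * ψ) * Real.cosh t)) * Real.exp (a * t)) := by
  set c := Real.sqrt (z / ψ) with hc
  have hc0 : 0 < c := Real.sqrt_pos.2 (by positivity)
  have hp : 0 < c * Real.exp t := by positivity
  have h1 : z / c = Real.sqrt (z * ψ) := by
    rw [hc, Real.sqrt_div hz.le, Real.sqrt_mul hz.le]
    have := Real.sqrt_pos.2 hz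
    field_simp
    rw [Real.sq_sqrt hz.le]
  have h2 : ψ * c = Real.sqrt (z * ψ) := by
    rw [hc, Real.sqrt_div hz.le, Real.sqrt_mul hz.le]
    have := Real.sqrt_pos.2 hψ
    field_simp
    rw [Real.sq_sqrt hψ.le]
  have h3 : z / (c * Real.exp t) + ψ * (c * Real.exp t) = 2 * (Real.sqrt (z * ψ) * Real.cosh t) := by
    rw [Real.cosh_eq, Real.exp_neg, ← div_div, h1, ← mul_assoc, h2]
    field_simp
    ring
  rw [h3, abs_of_pos hp, smul_eq_mul, Real.rpow_sub_one hp.ne', Real.mul_rpow hc0.le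
    (Real.exp_pos t).le, ← Real.exp_mul, mul_comm t a]
  field_simp

theorem image_mul_exp {c : ℝ} (hc : 0 < c) :
    (fun t => c * Real.exp t) '' Set.univ = Set.Ioi 0 := by
  ext y
  simp only [Set.image_univ, Set.mem_range, Set.mem_Ioi]
  refine ⟨fun ⟨t, ht⟩ => ht ▸ by positivity, fun hy => ⟨Real.log (y / c), ?_⟩⟩
  rw [Real.exp_log (by positivity)]
  field_simp

theorem gigIntegral_eq_integral_exp (a : ℝ) {ψ z : ℝ} (hψ : 0 < ψ) (hz : 0 < z) :
    gigIntegral a ψ z = Real.sqrt (z / ψ) ^ a *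
      ∫ t, Real.exp (-(Real.sqrt (z * ψ) * Real.cosh t)) * Real.exp (a * t) := by
  have hc0 : 0 < Real.sqrt (z / ψ) := Real.sqrt_pos.2 (by positivity)
  unfold gigIntegral
  rw [← image_mul_exp hc0, integral_image_eq_integral_abs_deriv_smul MeasurableSet.univ
    (f' := fun t => Real.sqrt (z / ψ) * Real.exp t)
    (fun t _ => ((Real.hasDerivAt_exp t).const_mul _).hasDerivWithinAt)
    (fun s _ t _ h => Real.exp_injective (mul_left_cancel₀ hc0.ne' h))]
  simp only [gig_integrand_exp a _ hψ hz, integral_const_mul, setIntegral_univ]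

theorem exp_cosh_integrable (a : ℝ) {x : ℝ} (hx : 0 < x) :
    Integrable fun t => Real.exp (-(x * Real.cosh t)) * Real.exp (a * t) := by
  have := gig_integrableOn a hx hx
  have hc0 : 0 < Real.sqrt (x / x) := Real.sqrt_pos.2 (by positivity)
  rw [← image_mul_exp hc0, integrableOn_image_iff_integrableOn_abs_deriv_smul MeasurableSet.univ
    (f' := fun t => Real.sqrt (x / x) * Real.exp t)
    (fun t _ => ((Real.hasDerivAt_exp t).const_mul _).hasDerivWithinAt)
    (fun s _ t _ h => Real.exp_injective (mul_left_cancel₀ hc0.ne' h)), integrableOn_univ] at this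
  simp only [gig_integrand_exp a _ hx hx] at this
  simpa only [div_self hx.ne', Real.sqrt_one, Real.one_rpow, one_mul,
    Real.sqrt_mul_self hx.le] using this

/-- Folding the line at 0 pairs e^{at} with e^{-at}, whose sum is 2 cosh(at). -/
theorem integral_exp_cosh_eq_besselK (a : ℝ) {x : ℝ} (hx : 0 < x) :
    ∫ t, Real.exp (-(x * Real.cosh t)) * Real.exp (a * t) = 2 * besselK a x := by
  have hi := exp_cosh_integrable a hx
  rw [← intervalIntegral.integral_Iic_add_Ioi (b := 0) hi.integrableOn hi.integrableOn]
  have h1 := integral_comp_neg_Ioi 0 fun t => Real.exp (-(x * Real.cosh t)) * Real.exp (a * t)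
  rw [neg_zero] at h1
  have hi' : Integrable fun t => Real.exp (-(x * Real.cosh (-t))) * Real.exp (a * -t) := hi.comp_neg
  rw [← h1, ← integral_add hi'.integrableOn hi.integrableOn, besselK, ← integral_const_mul]
  congr 1
  ext t
  rw [Real.cosh_neg, Real.cosh_eq (a * t), neg_mul, mul_neg]
  ring

theorem gigIntegral_eq_besselK (a : ℝ) {ψ z : ℝ} (hψ : 0 < ψ) (hz : 0 < z) :
    gigIntegral a ψ z = 2 * Real.sqrt (z / ψ) ^ a * besselK a (Real.sqrt (z * ψ)) := by
  rw [gigIntegral_eq_integral_exp a hψ hz, integral_exp_cosh_eq_besselK a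
    (Real.sqrt_pos.2 (by positivity))]
  ring

/-! ### Exponential decay of the integral in z -/

theorem Real.one_add_sq_div_two_le_cosh (t : ℝ) : 1 + t ^ 2 / 2 ≤ Real.cosh t := by
  wlog h : 0 ≤ t generalizing t
  · simpa using this (-t) (by linarith)
  have h1 := Real.cosh_two_mul (t / 2)
  rw [mul_div_cancel₀ t two_ne_zero, Real.cosh_sq'] at h1
  have h2 : t / 2 ≤ Real.sinh (t / 2) := Real.self_le_sinh_iff.2 (by linarith)
  nlinarith

theorem gaussian_linear_eq {b : ℝ} (hb : 0 < b) (c x : ℝ) :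
    Real.exp (-b * x ^ 2 + c * x) =
      Real.exp (c ^ 2 / (4 * b)) * Real.exp (-b * (x - c / (2 * b)) ^ 2) := by
  rw [← Real.exp_add]
  congr 1
  field_simp
  ring

theorem integrable_gaussian_linear {b : ℝ} (hb : 0 < b) (c : ℝ) :
    Integrable fun x : ℝ => Real.exp (-b * x ^ 2 + c * x) := by
  simp only [gaussian_linear_eq hb]
  exact ((integrable_exp_neg_mul_sq hb).comp_sub_right (c / (2 * b))).const_mul _

theorem integral_gaussian_linear {b : ℝ} (hb : 0 < b) (c : ℝ) :
    ∫ x : ℝ, Real.exp (-b * x ^ 2 + c * x) =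
      Real.sqrt (Real.pi / b) * Real.exp (c ^ 2 / (4 * b)) := by
  simp only [gaussian_linear_eq hb, integral_const_mul]
  rw [integral_sub_right_eq_self (fun x : ℝ => Real.exp (-b * x ^ 2)), integral_gaussian]
  ring

/-- Replacing cosh t by its lower bound 1 + t²/2 gives a Gaussian integral. With x = √(zψ), it
contributes e^{-x}, a factor x^(-1/2) (hence z^(-1/4)) and exp(a²/(2x)), bounded because z ≥ z₀. The
power z^(a/2) comes from the change of variables. -/
theorem exists_gigIntegral_le (a : ℝ) {ψ z₀ : ℝ} (hψ : 0 < ψ) (hz₀ : 0 < z₀) :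
    ∃ C : ℝ, ∀ z : ℝ, z₀ ≤ z →
      gigIntegral a ψ z ≤ C * (z ^ (a / 2 - 1 / 4) * Real.exp (-Real.sqrt (z * ψ))) := by
  refine ⟨ψ ^ (-a / 2 - 1 / 4) * Real.sqrt (2 * Real.pi) *
    Real.exp (a ^ 2 / (2 * Real.sqrt (z₀ * ψ))), fun z hz => ?_⟩
  have hz' := hz₀.trans_le hz
  rw [gigIntegral_eq_integral_exp a hψ hz']
  have hx : 0 < Real.sqrt (z * ψ) := Real.sqrt_pos.2 (by positivity)
  have hx0 : 0 < Real.sqrt (z₀ * ψ) := Real.sqrt_pos.2 (by positivity)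
  have hxx : Real.sqrt (z₀ * ψ) ≤ Real.sqrt (z * ψ) := Real.sqrt_le_sqrt (by gcongr)
  have e1 : Real.sqrt (2 * Real.pi / Real.sqrt (z * ψ)) =
      Real.sqrt (2 * Real.pi) * (z ^ (-(1 / 4) : ℝ) * ψ ^ (-(1 / 4) : ℝ)) := by
    rw [Real.sqrt_div (by positivity), ← Real.mul_rpow hz'.le hψ.le,
      Real.sqrt_eq_rpow (Real.sqrt _), Real.sqrt_eq_rpow (z * ψ), ← Real.rpow_mul (by positivity),
      div_eq_mul_inv, ← Real.rpow_neg (by positivity)]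
    norm_num
  have e2 : Real.sqrt (z / ψ) ^ a = z ^ (a / 2) * ψ ^ (-a / 2) := by
    rw [Real.sqrt_eq_rpow, ← Real.rpow_mul (by positivity), Real.div_rpow hz'.le hψ.le,
      div_eq_mul_inv, ← Real.rpow_neg hψ.le]
    ring_nf
  generalize Real.sqrt (z * ψ) = x at *
  generalize Real.sqrt (z₀ * ψ) = x₀ at *
  have hb : ∫ t, Real.exp (-(x * Real.cosh t)) * Real.exp (a * t) ≤
      Real.exp (-x) * (Real.sqrt (2 * Real.pi / x) * Real.exp (a ^ 2 / (2 * x₀))) := by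
    calc _ ≤ ∫ t : ℝ, Real.exp (-x) * Real.exp (-(x / 2) * t ^ 2 + a * t) := by
          refine integral_mono (exp_cosh_integrable a hx)
            ((integrable_gaussian_linear (half_pos hx) a).const_mul _) fun t => ?_
          simp only [← Real.exp_add]
          apply Real.exp_le_exp.2
          have := mul_le_mul_of_nonneg_left (Real.one_add_sq_div_two_le_cosh t) hx.le
          linarith
      _ = Real.exp (-x) * (Real.sqrt (2 * Real.pi / x) * Real.exp (a ^ 2 / (2 * x))) := by
          rw [integral_const_mul, integral_gaussian_linear (half_pos hx)]
          have e : Real.pi / (x / 2) = 2 * Real.pi / x := by field_simp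
          have e' : 4 * (x / 2) = 2 * x := by ring
          rw [e, e']
      _ ≤ _ := by gcongr
  calc _ ≤ _ := mul_le_mul_of_nonneg_left hb (by positivity)
    _ = _ := by
      have e3 : z ^ (a / 2 - 1 / 4) = z ^ (a / 2) * z ^ (-(1 / 4) : ℝ) := by
        rw [← Real.rpow_add hz']; ring_nf
      have e4 : ψ ^ (-a / 2 - 1 / 4) = ψ ^ (-a / 2) * ψ ^ (-(1 / 4) : ℝ) := by
        rw [← Real.rpow_add hψ]; ring_nf
      rw [e1, e2, e3, e4]
      ring

/-! ### The density as a mixture, and its normalization -/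

theorem sq_sub_sq_pos_of_abs_lt {α β : ℝ} (h : |β| < α) : 0 < α ^ 2 - β ^ 2 := by
  have := sq_lt_sq' (by linarith [neg_abs_le β]) (lt_of_abs_lt h)
  linarith

theorem sqrt_mul_rpow_sub_half {y : ℝ} (hy : 0 < y) (lam : ℝ) :
    Real.sqrt y * y ^ (lam - 1 / 2 - 1) = y ^ (lam - 1) := by
  rw [Real.sqrt_eq_rpow, ← Real.rpow_add hy]
  ring_nf

/-- The powers of α, δ, α² - β² and δ² + x² in the density are exactly the prefactors that turn both
Bessel functions into G integrals. -/
theorem ghPDF_eq (lam : ℝ) {α β δ : ℝ} (hδ : 0 < δ) (hαβ : |β| < α) (x : ℝ) :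
    ghPDF lam α β δ 0 x = (Real.sqrt (2 * Real.pi) * gigIntegral lam (α ^ 2 - β ^ 2) (δ ^ 2))⁻¹ *
      (Real.exp (β * x) * gigIntegral (lam - 1 / 2) (α ^ 2) (x ^ 2 + δ ^ 2)) := by
  have hα : 0 < α := (abs_nonneg β).trans_lt hαβ
  have hγ := sq_sub_sq_pos_of_abs_lt hαβ
  have hz : 0 < x ^ 2 + δ ^ 2 := by positivity
  have hK : 0 < gigIntegral lam (α ^ 2 - β ^ 2) (δ ^ 2) := gigIntegral_pos _ hγ (by positivity)
  rw [gigIntegral_eq_besselK lam hγ (by positivity)] at hK ⊢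
  rw [gigIntegral_eq_besselK _ (by positivity) hz, ghPDF, sub_zero, add_comm (δ ^ 2),
    Real.sqrt_mul (by positivity) (α ^ 2 - β ^ 2), Real.sqrt_sq hδ.le, Real.sqrt_mul hz.le,
    Real.sqrt_sq hα.le, mul_comm _ α, Real.sqrt_div (by positivity), Real.sqrt_sq hδ.le,
    Real.sqrt_div hz.le, Real.sqrt_sq hα.le, Real.div_rpow hδ.le (Real.sqrt_nonneg _),
    Real.div_rpow (Real.sqrt_nonneg _) hα.le]
  rw [Real.sqrt_mul (by positivity) (α ^ 2 - β ^ 2), Real.sqrt_sq hδ.le] at hK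
  have hB : besselK lam (δ * Real.sqrt (α ^ 2 - β ^ 2)) ≠ 0 := by
    intro h; rw [h, mul_zero] at hK; exact lt_irrefl _ hK
  have e1 : (α ^ 2 - β ^ 2) ^ (lam / 2) = Real.sqrt (α ^ 2 - β ^ 2) ^ lam := by
    rw [Real.sqrt_eq_rpow, ← Real.rpow_mul hγ.le]; ring_nf
  have e2 : (x ^ 2 + δ ^ 2) ^ ((lam - 1 / 2) / 2) = Real.sqrt (x ^ 2 + δ ^ 2) ^ (lam - 1 / 2) := by
    rw [Real.sqrt_eq_rpow, ← Real.rpow_mul hz.le]; ring_nf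
  have hγ' : 0 < Real.sqrt (α ^ 2 - β ^ 2) := Real.sqrt_pos.2 hγ
  rw [e1, e2]
  have p1 : 0 < Real.sqrt (α ^ 2 - β ^ 2) ^ lam := by positivity
  have p2 : 0 < α ^ (lam - 1 / 2) := by positivity
  have p3 : 0 < δ ^ lam := by positivity
  have p4 : 0 < Real.sqrt (2 * Real.pi) := by positivity
  field_simp

/-- GH is a normal mean-variance mixture. After Tonelli, the inner integral in x is Gaussian with
variance y: completing the square turns α² into α² - β², and its factor √y raises the index from lam
- 1/2 to lam. -/
theorem lintegral_exp_mul_gigIntegral (lam : ℝ) {α β δ : ℝ} (hδ : 0 < δ) (hαβ : |β| < α) :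
    ∫⁻ x : ℝ, ENNReal.ofReal
        (Real.exp (β * x) * gigIntegral (lam - 1 / 2) (α ^ 2) (x ^ 2 + δ ^ 2)) =
      ENNReal.ofReal (Real.sqrt (2 * Real.pi) * gigIntegral lam (α ^ 2 - β ^ 2) (δ ^ 2)) := by
  have hα : 0 < α := (abs_nonneg β).trans_lt hαβ
  have hγ := sq_sub_sq_pos_of_abs_lt hαβ
  have h1 : ∀ x : ℝ, ENNReal.ofReal
      (Real.exp (β * x) * gigIntegral (lam - 1 / 2) (α ^ 2) (x ^ 2 + δ ^ 2)) =
      ∫⁻ y in Set.Ioi (0 : ℝ), ENNReal.ofReal (Real.exp (β * x) *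
        (y ^ (lam - 1 / 2 - 1) * Real.exp (-((x ^ 2 + δ ^ 2) / y + α ^ 2 * y) / 2))) := by
    intro x
    rw [gigIntegral, ← integral_const_mul, ofReal_integral_eq_lintegral_ofReal]
    · exact (gig_integrableOn _ (by positivity) (by positivity)).const_mul _
    · filter_upwards [ae_restrict_mem measurableSet_Ioi] with y hy
      have hy : 0 < y := hy
      simp only [Pi.zero_apply]; positivity
  simp only [h1]
  rw [lintegral_lintegral_swap (by fun_prop), gigIntegral, ← integral_const_mul,
    ofReal_integral_eq_lintegral_ofReal]
  · refine setLIntegral_congr_fun measurableSet_Ioi fun y hy => ?_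
    have hy : 0 < y := hy
    have hb : 0 < 1 / (2 * y) := by positivity
    have e : ∀ x : ℝ, Real.exp (β * x) *
        (y ^ (lam - 1 / 2 - 1) * Real.exp (-((x ^ 2 + δ ^ 2) / y + α ^ 2 * y) / 2)) =
        (y ^ (lam - 1 / 2 - 1) * Real.exp (-(δ ^ 2 / y + α ^ 2 * y) / 2)) *
          Real.exp (-(1 / (2 * y)) * x ^ 2 + β * x) := fun x => by
      have : Real.exp (-((x ^ 2 + δ ^ 2) / y + α ^ 2 * y) / 2) * Real.exp (β * x) =
          Real.exp (-(δ ^ 2 / y + α ^ 2 * y) / 2) *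
            Real.exp (-(1 / (2 * y)) * x ^ 2 + β * x) := by
        rw [← Real.exp_add, ← Real.exp_add]
        congr 1
        field_simp
        ring
      linear_combination y ^ (lam - 1 / 2 - 1) * this
    simp only [e]
    rw [← ofReal_integral_eq_lintegral_ofReal ((integrable_gaussian_linear hb β).const_mul _)
      (Eventually.of_forall fun x => by simp only [Pi.zero_apply]; positivity),
      integral_const_mul, integral_gaussian_linear hb]
    congr 1
    have e1 : Real.pi / (1 / (2 * y)) = 2 * Real.pi * y := by field_simp
    have e2 : Real.exp (-(δ ^ 2 / y + α ^ 2 * y) / 2) * Real.exp (β ^ 2 / (4 * (1 / (2 * y)))) =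
        Real.exp (-(δ ^ 2 / y + (α ^ 2 - β ^ 2) * y) / 2) := by
      rw [← Real.exp_add]
      congr 1
      field_simp
      ring
    rw [e1, ← e2, Real.sqrt_mul (by positivity), ← sqrt_mul_rpow_sub_half hy lam]
    ring
  · exact (gig_integrableOn _ hγ (by positivity)).const_mul _
  · filter_upwards [ae_restrict_mem measurableSet_Ioi] with y hy
    have hy : 0 < y := hy
    simp only [Pi.zero_apply]; positivity

theorem gigIntegral_comp_continuous (a : ℝ) {ψ δ : ℝ} (hψ : 0 < ψ) (hδ : 0 < δ) :
    Continuous fun x : ℝ => gigIntegral a ψ (x ^ 2 + δ ^ 2) :=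
  continuous_iff_continuousAt.2 fun x =>
    (gigIntegral_hasDerivAt a hψ (by positivity : 0 < x ^ 2 + δ ^ 2)).continuousAt.comp
      (f := fun x : ℝ => x ^ 2 + δ ^ 2) (by fun_prop)

theorem ghPDF_continuous (lam : ℝ) {α β δ : ℝ} (hδ : 0 < δ) (hαβ : |β| < α) :
    Continuous (ghPDF lam α β δ 0) := by
  have hα : 0 < α := (abs_nonneg β).trans_lt hαβ
  rw [funext (ghPDF_eq lam hδ hαβ)]
  have := gigIntegral_comp_continuous (lam - 1 / 2) (by positivity : 0 < α ^ 2) hδ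
  fun_prop

theorem ghPDF_pos (lam : ℝ) {α β δ : ℝ} (hδ : 0 < δ) (hαβ : |β| < α) (x : ℝ) :
    0 < ghPDF lam α β δ 0 x := by
  have hα : 0 < α := (abs_nonneg β).trans_lt hαβ
  rw [ghPDF_eq lam hδ hαβ]
  have h1 := gigIntegral_pos lam (sq_sub_sq_pos_of_abs_lt hαβ) (by positivity : 0 < δ ^ 2)
  have h2 := gigIntegral_pos (lam - 1 / 2) (by positivity : 0 < α ^ 2)
    (by positivity : 0 < x ^ 2 + δ ^ 2)
  positivity

theorem ghMeasure_isProbabilityMeasure (lam : ℝ) {α β δ : ℝ} (hδ : 0 < δ) (hαβ : |β| < α) :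
    IsProbabilityMeasure (ghMeasure lam α β δ 0) := by
  have h1 := gigIntegral_pos lam (sq_sub_sq_pos_of_abs_lt hαβ) (by positivity : 0 < δ ^ 2)
  have hN : 0 < Real.sqrt (2 * Real.pi) * gigIntegral lam (α ^ 2 - β ^ 2) (δ ^ 2) := by positivity
  constructor
  rw [ghMeasure, withDensity_apply _ MeasurableSet.univ, Measure.restrict_univ]
  simp only [ghPDF_eq lam hδ hαβ, ENNReal.ofReal_mul (inv_nonneg.2 hN.le)]
  rw [lintegral_const_mul' _ _ ENNReal.ofReal_ne_top, lintegral_exp_mul_gigIntegral lam hδ hαβ,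
    ← ENNReal.ofReal_mul (inv_nonneg.2 hN.le), inv_mul_cancel₀ hN.ne', ENNReal.ofReal_one]

theorem ghMeasure_absolutelyContinuous (lam α β δ μ : ℝ) : ghMeasure lam α β δ μ ≪ volume :=
  withDensity_absolutelyContinuous _ _

theorem integrable_ghMeasure_iff (lam : ℝ) {α β δ : ℝ} (hδ : 0 < δ) (hαβ : |β| < α) (h : ℝ → ℝ) :
    Integrable h (ghMeasure lam α β δ 0) ↔ Integrable fun x => ghPDF lam α β δ 0 x * h x := by
  rw [ghMeasure, integrable_withDensity_iff_integrable_smul₀'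
    (ghPDF_continuous lam hδ hαβ).measurable.ennreal_ofReal.aemeasurable
    (Eventually.of_forall fun x => ENNReal.ofReal_lt_top)]
  simp only [ENNReal.toReal_ofReal (ghPDF_pos lam hδ hαβ _).le, smul_eq_mul]

theorem integral_ghMeasure (lam : ℝ) {α β δ : ℝ} (hδ : 0 < δ) (hαβ : |β| < α) (h : ℝ → ℝ) :
    ∫ x, h x ∂(ghMeasure lam α β δ 0) = ∫ x, ghPDF lam α β δ 0 x * h x := by
  rw [ghMeasure, integral_withDensity_eq_integral_toReal_smul
    (ghPDF_continuous lam hδ hαβ).measurable.ennreal_ofReal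
    (Eventually.of_forall fun x => ENNReal.ofReal_lt_top)]
  simp only [ENNReal.toReal_ofReal (ghPDF_pos lam hδ hαβ _).le, smul_eq_mul]

/-! ### The flux identity -/

theorem gigIntegral_comp_hasDerivAt (a : ℝ) {ψ δ : ℝ} (hψ : 0 < ψ) (hδ : 0 < δ) (x : ℝ) :
    HasDerivAt (fun x : ℝ => gigIntegral a ψ (x ^ 2 + δ ^ 2))
      (-(x * gigIntegral (a - 1) ψ (x ^ 2 + δ ^ 2))) x := by
  have h1 : HasDerivAt (fun x : ℝ => x ^ 2 + δ ^ 2) (2 * x) x := by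
    simpa using (hasDerivAt_pow 2 x).add_const (δ ^ 2)
  refine ((gigIntegral_hasDerivAt a hψ
    (by positivity : 0 < x ^ 2 + δ ^ 2)).comp x h1).congr_deriv ?_
  ring

/-- The quantity whose derivative is, up to a constant, the density times the Stein operator. Here
`g` is the exponentially tilted test function and `u x = g' x / x`. -/
noncomputable def ghFlux (lam α δ : ℝ) (g u : ℝ → ℝ) (x : ℝ) : ℝ :=
  (x ^ 2 + δ ^ 2) * gigIntegral (lam - 1 / 2) (α ^ 2) (x ^ 2 + δ ^ 2) * u x +
    α ^ 2 * gigIntegral (lam - 1 / 2 + 1) (α ^ 2) (x ^ 2 + δ ^ 2) * g x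

/-- Differentiation produces G_{ν-1} and G_{ν+1} as coefficients of x u, in the combination α²
G_{ν+1} - z G_{ν-1}. The recurrence makes this 2ν G_ν, so the whole derivative is a multiple of G_ν.
-/
theorem ghFlux_hasDerivAt (lam : ℝ) {α δ : ℝ} (hα : 0 < α) (hδ : 0 < δ) {g u : ℝ → ℝ} {x u' : ℝ}
    (hg : HasDerivAt g (x * u x) x) (hu : HasDerivAt u u' x) :
    HasDerivAt (ghFlux lam α δ g u)
      (gigIntegral (lam - 1 / 2) (α ^ 2) (x ^ 2 + δ ^ 2) *
        ((x ^ 2 + δ ^ 2) * u' + (2 * lam + 1) * x * u x - α ^ 2 * x * g x)) x := by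
  have hψ : 0 < α ^ 2 := by positivity
  have h1 : HasDerivAt (fun x : ℝ => x ^ 2 + δ ^ 2) (2 * x) x := by
    simpa using (hasDerivAt_pow 2 x).add_const (δ ^ 2)
  have hQ := gigIntegral_comp_hasDerivAt (lam - 1 / 2) hψ hδ x
  have hR := gigIntegral_comp_hasDerivAt (lam - 1 / 2 + 1) hψ hδ x
  rw [add_sub_cancel_right] at hR
  refine (((h1.mul hQ).mul hu).add ((hR.const_mul (α ^ 2)).mul hg)).congr_deriv ?_
  have hrec := gigIntegral_recurrence (lam - 1 / 2) hψ (by positivity : 0 < x ^ 2 + δ ^ 2)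
  simp only [Pi.mul_apply]
  linear_combination (x * u x) * hrec

/-- Conjugation by e^{βx} removes β from the operator: with g = e^{βx} f and u = g'/x, what remains
is z u' + (2 lam + 1) x u - α² x g, where u' = (x g'' - g')/x². -/
theorem exp_mul_ghStein (lam α β δ : ℝ) (f : ℝ → ℝ) {x : ℝ} (hx : x ≠ 0) :
    Real.exp (β * x) * ghStein lam α β δ f x =
      (x ^ 2 + δ ^ 2) * ((Real.exp (β * x) *
          (deriv (deriv f) x + 2 * β * deriv f x + β ^ 2 * f x) * x -
        Real.exp (β * x) * (deriv f x + β * f x)) / x ^ 2) +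
      (2 * lam + 1) * x * (Real.exp (β * x) * (deriv f x + β * f x) / x) -
      α ^ 2 * x * (Real.exp (β * x) * f x) := by
  unfold ghStein
  field_simp
  ring

theorem exp_mul_hasDerivAt (β : ℝ) {f : ℝ → ℝ} {f' x : ℝ} (hf : HasDerivAt f f' x) :
    HasDerivAt (fun x => Real.exp (β * x) * f x) (Real.exp (β * x) * (f' + β * f x)) x := by
  have h : HasDerivAt (fun x : ℝ => Real.exp (β * x)) (Real.exp (β * x) * (β * 1)) x :=
    ((hasDerivAt_id x).const_mul β).exp
  refine (h.mul hf).congr_deriv ?_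
  ring

theorem ghFlux_hasDerivAt_stein (lam : ℝ) {α β δ : ℝ} (hα : 0 < α) (hδ : 0 < δ) {f u : ℝ → ℝ}
    {x : ℝ} (hf : HasDerivAt f (deriv f x) x) (hf' : HasDerivAt (deriv f) (deriv (deriv f) x) x)
    (hx : x ≠ 0) (hu : ∀ y ≠ 0, u y = Real.exp (β * y) * (deriv f y + β * f y) / y) :
    HasDerivAt (ghFlux lam α δ (fun y => Real.exp (β * y) * f y) u)
      (gigIntegral (lam - 1 / 2) (α ^ 2) (x ^ 2 + δ ^ 2) *
        (Real.exp (β * x) * ghStein lam α β δ f x)) x := by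
  have h1 : HasDerivAt (fun y => Real.exp (β * y) * (deriv f y + β * f y))
      (Real.exp (β * x) * (deriv (deriv f) x + 2 * β * deriv f x + β ^ 2 * f x)) x := by
    refine (exp_mul_hasDerivAt β (hf'.add (hf.const_mul β))).congr_deriv ?_
    simp only [Pi.add_apply]
    ring
  have h2 : HasDerivAt u ((Real.exp (β * x) *
          (deriv (deriv f) x + 2 * β * deriv f x + β ^ 2 * f x) * x -
        Real.exp (β * x) * (deriv f x + β * f x)) / x ^ 2) x := by
    refine ((h1.div (hasDerivAt_id x) hx).congr_deriv (by simp)).congr_of_eventuallyEq ?_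
    filter_upwards [isOpen_ne.mem_nhds hx] with y hy
    exact hu y hy
  have h3 : HasDerivAt (fun y => Real.exp (β * y) * f y) (x * u x) x :=
    (exp_mul_hasDerivAt β hf).congr_deriv (by rw [hu x hx]; field_simp)
  refine (ghFlux_hasDerivAt lam hα hδ h3 h2).congr_deriv ?_
  rw [exp_mul_ghStein lam α β δ f hx, hu x hx]

/-! ### Behaviour of the flux at infinity -/

theorem eventually_one_le_abs_cocompact : ∀ᶠ x : ℝ in cocompact ℝ, 1 ≤ |x| :=
  tendsto_norm_cocompact_atTop.eventually_ge_atTop 1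

theorem sq_add_sq_rpow_isBigO (δ m : ℝ) :
    (fun x : ℝ => (x ^ 2 + δ ^ 2) ^ m) =O[cocompact ℝ] fun x => |x| ^ (2 * m) := by
  -- For |x| ≥ 1, x² ≤ x² + δ² ≤ (1 + δ²) x²; the exponent |m| serves both signs of m.
  refine Asymptotics.IsBigO.of_bound ((1 + δ ^ 2) ^ |m|) ?_
  filter_upwards [eventually_one_le_abs_cocompact] with x hx
  have hx2 : 1 ≤ x ^ 2 := (one_le_sq_iff_one_le_abs x).2 hx
  have hx0 : (0 : ℝ) < x ^ 2 := by linarith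
  have e : |x| ^ (2 * m) = (x ^ 2) ^ m := by
    rw [Real.rpow_mul (abs_nonneg x), Real.rpow_two, sq_abs]
  rw [Real.norm_of_nonneg (by positivity), Real.norm_of_nonneg (by positivity), e]
  have h1 : 1 ≤ (1 + δ ^ 2) ^ |m| := Real.one_le_rpow (by nlinarith [sq_nonneg δ]) (abs_nonneg m)
  rcases le_total 0 m with hm | hm
  · rw [abs_of_nonneg hm, ← Real.mul_rpow (by positivity) (by positivity)]
    exact Real.rpow_le_rpow (by positivity) (by nlinarith [sq_nonneg δ]) hm
  · calc _ ≤ (x ^ 2) ^ m :=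
        Real.rpow_le_rpow_of_nonpos hx0 (by nlinarith [sq_nonneg δ]) hm
      _ ≤ _ := le_mul_of_one_le_left (by positivity) h1

theorem gigIntegral_comp_isBigO (a : ℝ) {α δ : ℝ} (hα : 0 < α) (hδ : 0 < δ) :
    (fun x : ℝ => gigIntegral a (α ^ 2) (x ^ 2 + δ ^ 2)) =O[cocompact ℝ]
      fun x => |x| ^ (a - 1 / 2) * Real.exp (-α * |x|) := by
  obtain ⟨C, hC⟩ := exists_gigIntegral_le a (by positivity : 0 < α ^ 2)
    (by positivity : 0 < δ ^ 2)
  have h1 : (fun x : ℝ => gigIntegral a (α ^ 2) (x ^ 2 + δ ^ 2)) =O[cocompact ℝ]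
      fun x => (x ^ 2 + δ ^ 2) ^ (a / 2 - 1 / 4) * Real.exp (-α * |x|) := by
    refine Asymptotics.IsBigO.of_bound |C| (Eventually.of_forall fun x => ?_)
    have hz : 0 < x ^ 2 + δ ^ 2 := by positivity
    rw [Real.norm_of_nonneg (gigIntegral_pos a (by positivity) hz).le,
      Real.norm_of_nonneg (by positivity)]
    have h2 : α * |x| ≤ Real.sqrt ((x ^ 2 + δ ^ 2) * α ^ 2) := by
      rw [Real.sqrt_mul hz.le, Real.sqrt_sq hα.le, mul_comm]
      gcongr
      rw [← Real.sqrt_sq_eq_abs]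
      exact Real.sqrt_le_sqrt (by nlinarith [sq_nonneg δ])
    calc _ ≤ _ := hC _ (by nlinarith [sq_nonneg x])
      _ ≤ |C| * ((x ^ 2 + δ ^ 2) ^ (a / 2 - 1 / 4) *
          Real.exp (-Real.sqrt ((x ^ 2 + δ ^ 2) * α ^ 2))) := by
        gcongr
        exact le_abs_self C
      _ ≤ _ := by
        gcongr
        linarith
  refine h1.trans ?_
  have h3 := (sq_add_sq_rpow_isBigO δ (a / 2 - 1 / 4)).mul
    (Asymptotics.isBigO_refl (fun x : ℝ => Real.exp (-α * |x|)) (cocompact ℝ))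
  have e : 2 * (a / 2 - 1 / 4) = a - 1 / 2 := by ring
  rwa [e] at h3

/-- Both terms carry exactly the weight |x|^lam e^{-α|x|}. In the first, x² from z and |x|^(lam - 1)
from G_ν meet the 1/x in u; in the second, G_{ν+1} itself is of order |x|^lam. -/
theorem ghFlux_tendsto_zero {lam α β δ : ℝ} (hα : 0 < α) (hδ : 0 < δ) {f u : ℝ → ℝ}
    (hu : ∀ y ≠ 0, u y = Real.exp (β * y) * (deriv f y + β * f y) / y)
    (h0 : Tendsto (fun x : ℝ => |x| ^ lam * Real.exp (-α * |x| + β * x) * f x)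
      (cocompact ℝ) (𝓝 0))
    (h1 : Tendsto (fun x : ℝ => |x| ^ lam * Real.exp (-α * |x| + β * x) * deriv f x)
      (cocompact ℝ) (𝓝 0)) :
    Tendsto (ghFlux lam α δ (fun y => Real.exp (β * y) * f y) u) (cocompact ℝ) (𝓝 0) := by
  have hz := sq_add_sq_rpow_isBigO δ 1
  simp only [Real.rpow_one, mul_one] at hz
  have hQ := gigIntegral_comp_isBigO (lam - 1 / 2) hα hδ
  have hR := gigIntegral_comp_isBigO (lam - 1 / 2 + 1) hα hδ
  have hv := Asymptotics.isBigO_refl (fun x : ℝ => x⁻¹) (cocompact ℝ)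
  have hE := Asymptotics.isBigO_refl (fun x : ℝ => Real.exp (β * x) * (deriv f x + β * f x))
    (cocompact ℝ)
  have hF := Asymptotics.isBigO_refl (fun x : ℝ => Real.exp (β * x) * f x) (cocompact ℝ)
  have t1 : Tendsto (fun x : ℝ => (x ^ 2 + δ ^ 2) *
      gigIntegral (lam - 1 / 2) (α ^ 2) (x ^ 2 + δ ^ 2) * u x) (cocompact ℝ) (𝓝 0) := by
    have hb := h1.add (h0.const_mul β)
    rw [mul_zero, add_zero] at hb
    refine Asymptotics.IsBigO.trans_tendsto ?_ hb
    refine Asymptotics.IsBigO.trans (Asymptotics.IsBigO.congr' ((hz.mul hQ).mul (hv.mul hE)) ?_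
      EventuallyEq.rfl) ?_
    · filter_upwards [eventually_one_le_abs_cocompact] with x hx
      have : x ≠ 0 := abs_pos.1 (by linarith)
      rw [hu x this]
      field_simp
    · refine Asymptotics.IsBigO.of_bound 1 ?_
      filter_upwards [eventually_one_le_abs_cocompact] with x hx
      have hx0 : 0 < |x| := by linarith
      rw [one_mul]
      simp only [norm_mul, norm_inv, Real.norm_eq_abs]
      have e1 : |x| ^ lam = |x| ^ (2 : ℝ) * |x| ^ (lam - 1 / 2 - 1 / 2) * |x|⁻¹ := by
        rw [← Real.rpow_neg_one |x|, ← Real.rpow_add hx0, ← Real.rpow_add hx0]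
        ring_nf
      have e2 : |x| ^ lam * Real.exp (-α * |x| + β * x) * deriv f x +
          β * (|x| ^ lam * Real.exp (-α * |x| + β * x) * f x) =
          |x| ^ lam * (Real.exp (-α * |x|) * (Real.exp (β * x) * (deriv f x + β * f x))) := by
        rw [Real.exp_add]; ring
      rw [e2, abs_mul, abs_mul, abs_mul, e1]
      simp only [abs_mul, abs_inv, abs_abs]
      refine le_of_eq ?_
      ring
  have t2 : Tendsto (fun x : ℝ => α ^ 2 *
      gigIntegral (lam - 1 / 2 + 1) (α ^ 2) (x ^ 2 + δ ^ 2) * (Real.exp (β * x) * f x))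
      (cocompact ℝ) (𝓝 0) := by
    refine Asymptotics.IsBigO.trans_tendsto ((hR.const_mul_left (α ^ 2)).mul hF) (h0.congr fun x => ?_)
    rw [Real.exp_add, show lam - 1 / 2 + 1 - 1 / 2 = lam by ring]
    ring
  have h := t1.add t2
  rw [add_zero] at h
  exact h

/-! ### Necessity: the Stein operator has mean zero under GH -/

/-- Since Φ(x) = Φ(1) - ∫_x^1 I with I integrable, Φ stays bounded as x decreases to 0. This rules
out a 1/x singularity of the flux. -/
theorem tendsto_mul_nhdsGT_zero_of_integrable {Φ I : ℝ → ℝ} {S : Set ℝ} (hS : S.Countable)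
    (hI : Integrable I) (hc : ContinuousOn Φ (Set.Ioi 0))
    (hd : ∀ x, 0 < x → x ∉ S → HasDerivAt Φ (I x) x) :
    Tendsto (fun x => x * Φ x) (𝓝[>] 0) (𝓝 0) := by
  have hbd : ∀ᶠ x in 𝓝[>] (0 : ℝ), ‖x * Φ x‖ ≤ x * (|Φ 1| + ∫ y, ‖I y‖) := by
    filter_upwards [Ioo_mem_nhdsGT (zero_lt_one' ℝ)] with x hx
    have h1 := integral_eq_of_hasDerivAt_off_countable Φ I (a := x) (b := 1) hS
      (hc.mono fun y hy => by
        rw [Set.uIcc_of_le hx.2.le] at hy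
        exact hx.1.trans_le hy.1)
      (fun y hy => hd y (by
        have := hy.1.1
        rw [min_eq_left hx.2.le] at this
        exact hx.1.trans this) hy.2)
      hI.intervalIntegrable
    have h2 : ‖∫ y in x..1, I y‖ ≤ ∫ y, ‖I y‖ :=
      intervalIntegral.norm_integral_le_integral_norm_uIoc.trans
        (setIntegral_le_integral hI.norm (Eventually.of_forall fun y => norm_nonneg _))
    rw [norm_mul, Real.norm_of_nonneg hx.1.le]
    refine mul_le_mul_of_nonneg_left ?_ hx.1.le
    rw [h1, Real.norm_eq_abs] at h2
    rw [Real.norm_eq_abs]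
    have := abs_sub_abs_le_abs_sub (Φ x) (Φ 1)
    rw [abs_sub_comm] at this
    linarith
  refine squeeze_zero_norm' hbd ?_
  have : Tendsto (fun x : ℝ => x * (|Φ 1| + ∫ y, ‖I y‖)) (𝓝 0) (𝓝 (0 * (|Φ 1| + ∫ y, ‖I y‖))) :=
    tendsto_id.mul_const _
  rw [zero_mul] at this
  exact this.mono_left nhdsWithin_le_nhds

theorem integral_eq_zero_of_hasDerivAt_off_countable {Φ I : ℝ → ℝ} {S : Set ℝ} (hS : S.Countable)
    (hI : Integrable I) (hc : Continuous Φ) (hd : ∀ x ∉ S, HasDerivAt Φ (I x) x)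
    (hlim : Tendsto Φ (cocompact ℝ) (𝓝 0)) : ∫ x, I x = 0 := by
  have h1 := intervalIntegral_tendsto_integral hI tendsto_neg_atTop_atBot tendsto_id
  have h2 : Tendsto (fun r : ℝ => Φ r - Φ (-r)) atTop (𝓝 (0 - 0)) :=
    (hlim.mono_left atTop_le_cocompact).sub
      ((hlim.mono_left atBot_le_cocompact).comp tendsto_neg_atTop_atBot)
  rw [sub_zero] at h2
  refine tendsto_nhds_unique h1 (h2.congr fun r => ?_)
  exact (integral_eq_of_hasDerivAt_off_countable Φ I hS hc.continuousOn
    (fun x hx => hd x hx.2) hI.intervalIntegrable).symm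

theorem integral_ghStein_eq_zero {lam α β δ : ℝ} (hδ : 0 < δ) (hαβ : |β| < α) {f : ℝ → ℝ}
    (hf : IsGHTestFunction lam α β δ f) :
    ∫ x, ghStein lam α β δ f x ∂(ghMeasure lam α β δ 0) = 0 := by
  have hα : 0 < α := (abs_nonneg β).trans_lt hαβ
  have hψ : 0 < α ^ 2 := by positivity
  have hN : 0 < Real.sqrt (2 * Real.pi) * gigIntegral lam (α ^ 2 - β ^ 2) (δ ^ 2) := by
    have := gigIntegral_pos lam (sq_sub_sq_pos_of_abs_lt hαβ) (by positivity : 0 < δ ^ 2)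
    positivity
  obtain ⟨⟨hf1, S, hS, -⟩, hf0, hint, hdec⟩ := hf
  obtain ⟨hfd, hfc⟩ := contDiff_one_iff_deriv.1 hf1
  have hfcont := hf1.continuous
  set I : ℝ → ℝ := fun x => gigIntegral (lam - 1 / 2) (α ^ 2) (x ^ 2 + δ ^ 2) *
    (Real.exp (β * x) * ghStein lam α β δ f x) with hIdef
  have hpdf : ∀ x, ghPDF lam α β δ 0 x * ghStein lam α β δ f x =
      (Real.sqrt (2 * Real.pi) * gigIntegral lam (α ^ 2 - β ^ 2) (δ ^ 2))⁻¹ * I x := fun x => by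
    rw [ghPDF_eq lam hδ hαβ, hIdef]; ring
  have hI : Integrable I := by
    rw [integrable_ghMeasure_iff lam hδ hαβ] at hint
    simp only [hpdf] at hint
    exact (integrable_const_mul_iff (inv_ne_zero hN.ne').isUnit I).1 hint
  have hd2 : ∀ x, ContDiffAt ℝ 2 f x → HasDerivAt (deriv f) (deriv (deriv f) x) x := fun x hx =>
    ((hx.derivWithin (m := 1) (by norm_num)).differentiableAt one_ne_zero).hasDerivAt
  have hS' : ((S : Set ℝ) ∪ {0}).Countable := S.countable_toSet.union (Set.countable_singleton 0)
  have hderiv : ∀ u : ℝ → ℝ, (∀ y ≠ 0, u y = Real.exp (β * y) * (deriv f y + β * f y) / y) →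
      ∀ x ∉ ((S : Set ℝ) ∪ {0}),
        HasDerivAt (ghFlux lam α δ (fun y => Real.exp (β * y) * f y) u) (I x) x := by
    intro u hu x hx
    simp only [Set.mem_union, Finset.mem_coe, Set.mem_singleton_iff, not_or] at hx
    exact ghFlux_hasDerivAt_stein lam hα hδ (hfd x).hasDerivAt (hd2 x (hS x hx.1)) hx.2 hu
  have hQc := gigIntegral_comp_continuous (lam - 1 / 2) hψ hδ
  have hRc := gigIntegral_comp_continuous (lam - 1 / 2 + 1) hψ hδ
  set g₁ : ℝ → ℝ := fun y => Real.exp (β * y) * (deriv f y + β * f y) with hg₁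
  have hg₁c : Continuous g₁ := by fun_prop
  -- As x decreases to 0, x times the flux tends to δ² G_ν(δ²) g'(0), by continuity, and to 0, by
  -- integrability of its derivative. Hence g'(0) = 0.
  have hg₁0 : g₁ 0 = 0 := by
    have h1 := tendsto_mul_nhdsGT_zero_of_integrable
      (Φ := ghFlux lam α δ (fun y => Real.exp (β * y) * f y) fun y => g₁ y / y) hS' hI
      (by
        unfold ghFlux
        refine ((by fun_prop : Continuous fun x : ℝ => (x ^ 2 + δ ^ 2) *
          gigIntegral (lam - 1 / 2) (α ^ 2) (x ^ 2 + δ ^ 2)).continuousOn.mul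
            (hg₁c.continuousOn.div continuousOn_id fun x hx => ne_of_gt hx)).add
          (by fun_prop : Continuous _).continuousOn)
      (fun x _ hxS => hderiv _ (fun y _ => rfl) x hxS)
    have h2 : Continuous fun x : ℝ => (x ^ 2 + δ ^ 2) *
        gigIntegral (lam - 1 / 2) (α ^ 2) (x ^ 2 + δ ^ 2) * g₁ x +
        x * (α ^ 2 * gigIntegral (lam - 1 / 2 + 1) (α ^ 2) (x ^ 2 + δ ^ 2) *
          (Real.exp (β * x) * f x)) := by fun_prop
    have h3 := (h2.tendsto 0).mono_left (nhdsWithin_le_nhds (s := Set.Ioi 0))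
    have h4 := tendsto_nhds_unique (h3.congr' ?_) h1
    · simp only [zero_mul, add_zero] at h4
      have := gigIntegral_pos (lam - 1 / 2) hψ (by positivity : (0 : ℝ) < 0 ^ 2 + δ ^ 2)
      have hz : (0 : ℝ) < 0 ^ 2 + δ ^ 2 := by positivity
      exact (mul_eq_zero.1 h4).resolve_left (by positivity)
    · filter_upwards [self_mem_nhdsWithin] with x hx
      have hx : x ≠ 0 := ne_of_gt hx
      simp only [ghFlux]
      field_simp
  -- Because g'(0) = 0, the quotient g'(y)/y is the slope of g' from 0. Twice differentiability of f
  -- at 0 makes it continuous there, so the flux is continuous on the whole line and 0 joins the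
  -- exceptional countable set.
  have hu : ∀ y ≠ 0, dslope g₁ 0 y = g₁ y / y := fun y hy => by
    rw [dslope_of_ne _ hy, slope_def_field, hg₁0, sub_zero, sub_zero]
  have huc : Continuous (dslope g₁ 0) := by
    rw [← continuousOn_univ, continuousOn_dslope univ_mem]
    refine ⟨hg₁c.continuousOn, ?_⟩
    have := (hd2 0 hf0).differentiableAt
    have h' := hfd 0
    fun_prop
  rw [integral_ghMeasure lam hδ hαβ]
  simp only [hpdf]
  rw [integral_const_mul, integral_eq_zero_of_hasDerivAt_off_countable hS' hI
    (Φ := ghFlux lam α δ (fun y => Real.exp (β * y) * f y) (dslope g₁ 0))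
    (by unfold ghFlux; fun_prop) (hderiv _ hu) (ghFlux_tendsto_zero hα hδ hu ?_ ?_), mul_zero]
  · simpa only [iteratedDeriv_zero] using hdec 0 (by norm_num)
  · simpa only [iteratedDeriv_one] using hdec 1 (by norm_num)

/-! ### Polynomial growth -/

/-- Functions on `ℝ` of at most polynomial growth at infinity. -/
def PolyGrowth (u : ℝ → ℝ) : Prop := ∃ m : ℝ, u =O[cocompact ℝ] fun x => |x| ^ m

namespace PolyGrowth

theorem mul {u v : ℝ → ℝ} (hu : PolyGrowth u) (hv : PolyGrowth v) :
    PolyGrowth fun x => u x * v x := by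
  obtain ⟨m, hm⟩ := hu
  obtain ⟨n, hn⟩ := hv
  refine ⟨m + n, (hm.mul hn).congr' EventuallyEq.rfl ?_⟩
  filter_upwards [eventually_one_le_abs_cocompact] with x hx
  rw [Real.rpow_add (by linarith)]

theorem add {u v : ℝ → ℝ} (hu : PolyGrowth u) (hv : PolyGrowth v) :
    PolyGrowth fun x => u x + v x := by
  obtain ⟨m, hm⟩ := hu
  obtain ⟨n, hn⟩ := hv
  have key : ∀ {p q : ℝ}, p ≤ q →
      (fun x : ℝ => |x| ^ p) =O[cocompact ℝ] fun x => |x| ^ q := fun {p q} hpq => by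
    refine Asymptotics.IsBigO.of_bound 1 ?_
    filter_upwards [eventually_one_le_abs_cocompact] with x hx
    rw [Real.norm_of_nonneg (by positivity), Real.norm_of_nonneg (by positivity), one_mul]
    exact Real.rpow_le_rpow_of_exponent_le hx hpq
  exact ⟨max m n, (hm.trans (key (le_max_left m n))).add (hn.trans (key (le_max_right m n)))⟩

theorem of_bound {u : ℝ → ℝ} (C : ℝ) (h : ∀ x, |u x| ≤ C) : PolyGrowth u :=
  ⟨0, Asymptotics.IsBigO.of_bound C (Eventually.of_forall fun x => by simpa using h x)⟩

theorem const (c : ℝ) : PolyGrowth fun _ => c := of_bound |c| fun _ => le_rfl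

theorem id : PolyGrowth fun x => x :=
  ⟨1, Asymptotics.IsBigO.of_bound 1 (Eventually.of_forall fun x => by simp)⟩

theorem of_eventually_eq_zero {u : ℝ → ℝ} {M : ℝ} (h : ∀ x, M ≤ |x| → u x = 0) : PolyGrowth u :=
  ⟨0, Asymptotics.IsBigO.of_bound 1 (by
    filter_upwards [tendsto_norm_cocompact_atTop.eventually_ge_atTop M] with x hx
    simp [h x hx])⟩

theorem sq_add_sq_rpow (δ m : ℝ) : PolyGrowth fun x => (x ^ 2 + δ ^ 2) ^ m :=
  ⟨2 * m, sq_add_sq_rpow_isBigO δ m⟩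

theorem tendsto_zero {u : ℝ → ℝ} (hu : PolyGrowth u) (lam : ℝ) {α : ℝ} (hα : 0 < α) :
    Tendsto (fun x => |x| ^ lam * Real.exp (-α * |x|) * u x) (cocompact ℝ) (𝓝 0) := by
  obtain ⟨m, hm⟩ := hu
  have h1 := (tendsto_rpow_mul_exp_neg_mul_atTop_nhds_zero (lam + m) α hα).comp
    (tendsto_norm_cocompact_atTop (E := ℝ))
  refine Asymptotics.IsBigO.trans_tendsto
    (((Asymptotics.isBigO_refl (fun x : ℝ => |x| ^ lam * Real.exp (-α * |x|)) _).mul hm).congr'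
      EventuallyEq.rfl ?_) h1
  filter_upwards [eventually_one_le_abs_cocompact] with x hx
  simp only [Function.comp_apply, Real.norm_eq_abs]
  rw [Real.rpow_add (by linarith)]
  ring

theorem gigIntegral_comp (a : ℝ) {ψ δ : ℝ} (hψ : 0 < ψ) (hδ : 0 < δ) :
    PolyGrowth fun x => gigIntegral a ψ (x ^ 2 + δ ^ 2) :=
  of_bound (gigIntegral a ψ (δ ^ 2)) fun x => by
    rw [abs_of_pos (gigIntegral_pos a hψ (by positivity))]
    exact gigIntegral_le a hψ (by positivity) (by nlinarith [sq_nonneg x])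

end PolyGrowth

/-! ### Sufficiency: solving the Stein equation -/

theorem contDiff_two_of_hasDerivAt {f f₁ f₂ : ℝ → ℝ} (h1 : ∀ x, HasDerivAt f (f₁ x) x)
    (h2 : ∀ x, HasDerivAt f₁ (f₂ x) x) (hc : Continuous f₂) : ContDiff ℝ 2 f := by
  have e1 : deriv f = f₁ := funext fun x => (h1 x).deriv
  have e2 : deriv f₁ = f₂ := funext fun x => (h2 x).deriv
  rw [show (2 : WithTop ℕ∞) = 1 + 1 by norm_num, contDiff_succ_iff_deriv, e1,
    contDiff_one_iff_deriv, e2]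
  exact ⟨fun x => (h1 x).differentiableAt, by simp, fun x => (h2 x).differentiableAt, hc⟩

/-- Integrating from -M gives zero on the left by the support condition, and zero on the right
because the total integral vanishes. -/
theorem exists_primitive_of_integral_eq_zero {q : ℝ → ℝ} (hq : Continuous q) {M : ℝ}
    (hM : ∀ x, M ≤ |x| → q x = 0) (h0 : ∫ x, q x = 0) :
    ∃ F : ℝ → ℝ, (∀ x, HasDerivAt F (q x) x) ∧ ∀ x, M ≤ |x| → F x = 0 := by
  have hsupp : ∀ y, q y ≠ 0 → |y| < M := fun y hy => by
    by_contra h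
    exact hy (hM y (not_lt.1 h))
  refine ⟨fun x => ∫ y in (-M)..x, q y, fun x => ?_, fun x hx => ?_⟩
  · exact (hq.integral_hasStrictDerivAt (-M) x).hasDerivAt
  · rcases le_abs.1 hx with h | h
    · refine (intervalIntegral.integral_eq_integral_of_support_subset fun y hy => ?_).trans h0
      have := abs_lt.1 (hsupp y hy)
      exact ⟨this.1, by linarith⟩
    · have : ∫ y in (-M)..x, q y = ∫ y in (-M)..x, (0 : ℝ) := by
        refine intervalIntegral.integral_congr fun y hy => hM y ?_
        rw [Set.uIcc_of_ge (by linarith)] at hy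
        rw [le_abs]
        right
        linarith [hy.2]
      simpa using this

theorem exists_bounded_primitive {q : ℝ → ℝ} (hq : Continuous q) {M : ℝ}
    (hM : ∀ x, M ≤ |x| → q x = 0) :
    ∃ F : ℝ → ℝ, (∀ x, HasDerivAt F (q x) x) ∧ ∃ C, ∀ x, |F x| ≤ C := by
  have hi : Integrable q := by
    refine hq.integrable_of_hasCompactSupport
      (HasCompactSupport.intro (isCompact_Icc (a := -M) (b := M)) fun x hx => hM x ?_)
    by_contra h
    have := abs_lt.1 (not_le.1 h)
    exact hx ⟨this.1.le, this.2.le⟩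
  refine ⟨fun x => ∫ y in (0 : ℝ)..x, q y, fun x =>
    (hq.integral_hasStrictDerivAt 0 x).hasDerivAt, ∫ y, ‖q y‖, fun x => ?_⟩
  exact intervalIntegral.norm_integral_le_integral_norm_uIoc.trans
    (setIntegral_le_integral hi.norm (Eventually.of_forall fun y => norm_nonneg _))

theorem sq_add_sq_rpow_hasDerivAt {δ : ℝ} (hδ : 0 < δ) (m x : ℝ) :
    HasDerivAt (fun x : ℝ => (x ^ 2 + δ ^ 2) ^ m) (2 * x * m * (x ^ 2 + δ ^ 2) ^ (m - 1)) x := by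
  have h1 : HasDerivAt (fun x : ℝ => x ^ 2 + δ ^ 2) (2 * x) x := by
    simpa using (hasDerivAt_pow 2 x).add_const (δ ^ 2)
  exact h1.rpow_const (Or.inl (by positivity))

/-- The reduced Stein equation: for compactly supported `k` orthogonal to the density, there are
`g` and `u` with `g' = x u` and `(x² + δ²) u' + (2 lam + 1) x u - α² x g = k`. -/
theorem exists_reduced_stein_solution (lam : ℝ) {α δ : ℝ} (hα : 0 < α) (hδ : 0 < δ) {k : ℝ → ℝ}
    (hk : Continuous k) {M : ℝ} (hM : ∀ x, M ≤ |x| → k x = 0)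
    (h0 : ∫ x, gigIntegral (lam - 1 / 2) (α ^ 2) (x ^ 2 + δ ^ 2) * k x = 0) :
    ∃ g u : ℝ → ℝ, PolyGrowth g ∧ PolyGrowth u ∧ (∀ x, HasDerivAt g (x * u x) x) ∧
      ∀ x, HasDerivAt u
        ((k x - (2 * lam + 1) * x * u x + α ^ 2 * x * g x) * (x ^ 2 + δ ^ 2) ^ (-1 : ℝ)) x := by
  have hψ : 0 < α ^ 2 := by positivity
  set ν := lam - 1 / 2 with hν
  set Q : ℝ → ℝ := fun x => gigIntegral ν (α ^ 2) (x ^ 2 + δ ^ 2) with hQ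
  set R : ℝ → ℝ := fun x => gigIntegral (ν + 1) (α ^ 2) (x ^ 2 + δ ^ 2) with hR
  have hz : ∀ x : ℝ, 0 < x ^ 2 + δ ^ 2 := fun x => by positivity
  have hQpos : ∀ x, 0 < Q x := fun x => gigIntegral_pos ν hψ (hz x)
  have hQc : Continuous Q := gigIntegral_comp_continuous ν hψ hδ
  have hQd : ∀ x, HasDerivAt Q (-(x * gigIntegral (ν - 1) (α ^ 2) (x ^ 2 + δ ^ 2))) x :=
    gigIntegral_comp_hasDerivAt ν hψ hδ
  have hRd := gigIntegral_comp_hasDerivAt (ν + 1) hψ hδ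
  have hzd := fun m => sq_add_sq_rpow_hasDerivAt hδ m
  have hzm : ∀ x : ℝ, (x ^ 2 + δ ^ 2) ^ (-ν) = (x ^ 2 + δ ^ 2) * (x ^ 2 + δ ^ 2) ^ (-ν - 1) :=
    fun x => by
      rw [Real.rpow_sub_one (hz x).ne']
      have := (hz x).ne'
      field_simp
  -- Φ is the prescribed flux of the solution; orthogonality to the density is what makes it vanish
  -- on both sides.
  obtain ⟨Φ, hΦd, hΦ0⟩ := exists_primitive_of_integral_eq_zero (hQc.mul hk) (M := M)
    (fun x hx => by simp [hM x hx]) h0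
  have hΦc : Continuous Φ := continuous_iff_continuousAt.2 fun x => (hΦd x).continuousAt
  have hzc : Continuous fun x : ℝ => (x ^ 2 + δ ^ 2) ^ (-ν) :=
    continuous_iff_continuousAt.2 fun x => (hzd (-ν) x).continuousAt
  have hzpos : ∀ x : ℝ, 0 < (x ^ 2 + δ ^ 2) ^ (-ν) := fun x => Real.rpow_pos_of_pos (hz x) _
  -- Variation of constants for z Q g'/x + α² R g = Φ. By the recurrence, z^(-ν) Q has derivative
  -- -α² x z^(-ν-1) R, so it solves the homogeneous equation; v is the varying coefficient. Its
  -- derivative has compact support, so v is bounded.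
  obtain ⟨v, hvd, C, hvC⟩ := exists_bounded_primitive
    (q := fun x => x * Φ x / ((x ^ 2 + δ ^ 2) * Q x * ((x ^ 2 + δ ^ 2) ^ (-ν) * Q x)))
    (Continuous.div (by fun_prop) (by fun_prop) fun x => by
      have := hz x
      have := hQpos x
      have := hzpos x
      positivity) (M := M)
    (fun x hx => by simp [hΦ0 x hx])
  set g : ℝ → ℝ := fun x => (x ^ 2 + δ ^ 2) ^ (-ν) * Q x * v x with hg
  -- This is g'/x with the factor x cancelled symbolically, so it is differentiable at 0 as well.
  set u : ℝ → ℝ := fun x => -α ^ 2 * ((x ^ 2 + δ ^ 2) ^ (-ν - 1) * (R x * v x)) +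
    Φ x / ((x ^ 2 + δ ^ 2) * Q x) with hu
  have hgd : ∀ x, HasDerivAt g (x * u x) x := fun x => by
    refine (((hzd (-ν) x).mul (hQd x)).mul (hvd x)).congr_deriv ?_
    have hrec := gigIntegral_recurrence ν hψ (hz x)
    have h1 := hz x
    have h2 := hQpos x
    have h3 := hzpos x
    have e : (x ^ 2 + δ ^ 2) ^ (-ν) * Q x * (x * Φ x /
        ((x ^ 2 + δ ^ 2) * Q x * ((x ^ 2 + δ ^ 2) ^ (-ν) * Q x))) =
        x * (Φ x / ((x ^ 2 + δ ^ 2) * Q x)) := by field_simp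
    simp only [Pi.mul_apply]
    rw [e, hzm x]
    simp only [hu, hR, hQ]
    linear_combination (x * (x ^ 2 + δ ^ 2) ^ (-ν - 1) * v x) * hrec
  have hud : ∀ x, DifferentiableAt ℝ u x := fun x => by
    have h1 := (hzd (-ν - 1) x).differentiableAt
    have h2 : DifferentiableAt ℝ R x := (hRd x).differentiableAt
    have h3 := (hvd x).differentiableAt
    have h4 := (hΦd x).differentiableAt
    have h5 := (hQd x).differentiableAt
    have h6 : (x ^ 2 + δ ^ 2) * Q x ≠ 0 := (mul_pos (hz x) (hQpos x)).ne'
    fun_prop (disch := assumption)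
  have hflux : ghFlux lam α δ g u = Φ := funext fun x => by
    have h1 := (hz x).ne'
    have h2 := (hQpos x).ne'
    simp only [ghFlux, ← hν]
    change (x ^ 2 + δ ^ 2) * Q x * u x + α ^ 2 * R x * g x = Φ x
    simp only [hg, hu, hzm x]
    field_simp
    ring
  refine ⟨g, u, ?_, ?_, hgd, fun x => ?_⟩
  · exact ((PolyGrowth.sq_add_sq_rpow δ (-ν)).mul (PolyGrowth.gigIntegral_comp ν hψ hδ)).mul
      (PolyGrowth.of_bound C hvC)
  · exact ((PolyGrowth.const _).mul ((PolyGrowth.sq_add_sq_rpow δ (-ν - 1)).mul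
      ((PolyGrowth.gigIntegral_comp (ν + 1) hψ hδ).mul (PolyGrowth.of_bound C hvC)))).add
      (PolyGrowth.of_eventually_eq_zero (M := M) fun x hx => by simp [hΦ0 x hx])
  · have h1 := ghFlux_hasDerivAt lam hα hδ (hgd x) (hud x).hasDerivAt
    rw [hflux] at h1
    have h2 := mul_left_cancel₀ (hQpos x).ne' (h1.unique (hΦd x))
    refine (hud x).hasDerivAt.congr_deriv ?_
    rw [Real.rpow_neg_one, ← h2]
    have := (hz x).ne'
    field_simp
    ring

/-- Undo the tilt: f = e^{-βx} g, where g' = x u and g'' = u + x u' are continuous, so f is C²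
without breaks. The factor e^{-βx} cancels e^{βx} in the decay weight, and polynomial growth of g,
u, u' is beaten by e^{-α|x|}. -/
theorem exists_isGHTestFunction_ghStein_eq (lam : ℝ) {α β δ : ℝ} (hδ : 0 < δ) (hαβ : |β| < α)
    {h : ℝ → ℝ} (hc : Continuous h) (hs : HasCompactSupport h)
    (h0 : ∫ x, h x ∂(ghMeasure lam α β δ 0) = 0) :
    ∃ f, IsGHTestFunction lam α β δ f ∧ ∀ x ≠ 0, ghStein lam α β δ f x = h x := by
  have hα : 0 < α := (abs_nonneg β).trans_lt hαβ
  have hprob := ghMeasure_isProbabilityMeasure lam hδ hαβ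
  obtain ⟨M, hM⟩ : ∃ M : ℝ, ∀ x, M ≤ |x| → h x = 0 := by
    obtain ⟨M, hM⟩ := hs.isCompact.isBounded.subset_ball (0 : ℝ)
    refine ⟨M, fun x hx => image_eq_zero_of_notMem_tsupport fun hx' => ?_⟩
    have := hM hx'
    rw [mem_ball_zero_iff, Real.norm_eq_abs] at this
    linarith
  obtain ⟨g, u, hgG, huG, hgd, hud⟩ := exists_reduced_stein_solution lam hα hδ
    (k := fun x => Real.exp (β * x) * h x) (by fun_prop) (M := M)
    (fun x hx => by simp [hM x hx]) (by
      rw [integral_ghMeasure lam hδ hαβ] at h0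
      simp only [ghPDF_eq lam hδ hαβ, mul_assoc, integral_const_mul] at h0
      have hN : 0 < gigIntegral lam (α ^ 2 - β ^ 2) (δ ^ 2) :=
        gigIntegral_pos lam (sq_sub_sq_pos_of_abs_lt hαβ) (by positivity)
      have hN' : (Real.sqrt (2 * Real.pi) * gigIntegral lam (α ^ 2 - β ^ 2) (δ ^ 2))⁻¹ ≠ 0 := by
        positivity
      refine Eq.trans ?_ ((mul_eq_zero.1 h0).resolve_left hN')
      congr 1
      ext x
      ring)
  set u' : ℝ → ℝ := fun x => (Real.exp (β * x) * h x - (2 * lam + 1) * x * u x +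
    α ^ 2 * x * g x) * (x ^ 2 + δ ^ 2) ^ (-1 : ℝ) with hu'
  have hgc : Continuous g := continuous_iff_continuousAt.2 fun x => (hgd x).continuousAt
  have huc : Continuous u := continuous_iff_continuousAt.2 fun x => (hud x).continuousAt
  have hzc : Continuous fun x : ℝ => (x ^ 2 + δ ^ 2) ^ (-1 : ℝ) :=
    continuous_iff_continuousAt.2 fun x => (sq_add_sq_rpow_hasDerivAt hδ (-1) x).continuousAt
  have hu'c : Continuous u' := by fun_prop
  have hu'G : PolyGrowth u' := by
    have hkG : PolyGrowth fun x => Real.exp (β * x) * h x :=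
      PolyGrowth.of_eventually_eq_zero (M := M) fun x hx => by simp [hM x hx]
    have := ((hkG.add (((PolyGrowth.const (-(2 * lam + 1))).mul PolyGrowth.id).mul huG)).add
      (((PolyGrowth.const (α ^ 2)).mul PolyGrowth.id).mul hgG)).mul
        (PolyGrowth.sq_add_sq_rpow δ (-1))
    refine (funext fun x => ?_ : u' = _) ▸ this
    simp only [hu']
    ring
  set f : ℝ → ℝ := fun x => Real.exp (-β * x) * g x with hf
  set f₁ : ℝ → ℝ := fun x => Real.exp (-β * x) * (x * u x + -β * g x) with hf₁
  set f₂ : ℝ → ℝ := fun x => Real.exp (-β * x) * ((u x + x * u' x + -β * (x * u x)) +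
    -β * (x * u x + -β * g x)) with hf₂
  have hd1 : ∀ x, HasDerivAt f (f₁ x) x := fun x => exp_mul_hasDerivAt (-β) (hgd x)
  have hd2 : ∀ x, HasDerivAt f₁ (f₂ x) x := fun x => by
    refine exp_mul_hasDerivAt (-β) (((((hasDerivAt_id x).mul (hud x)).congr_deriv ?_).add
      ((hgd x).const_mul (-β))))
    simp [hu']
  have e1 : deriv f = f₁ := funext fun x => (hd1 x).deriv
  have e2 : deriv f₁ = f₂ := funext fun x => (hd2 x).deriv
  have hcd : ContDiff ℝ 2 f := contDiff_two_of_hasDerivAt hd1 hd2 (by fun_prop)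
  have hstein : ∀ x ≠ 0, ghStein lam α β δ f x = h x := fun x hx => by
    have hE : Real.exp (β * x) * Real.exp (-β * x) = 1 := by
      rw [← Real.exp_add]; simp
    have hz : x ^ 2 + δ ^ 2 ≠ 0 := by positivity
    have key := exp_mul_ghStein lam α β δ f hx
    rw [e1, e2] at key
    have k1 : Real.exp (β * x) * (f₂ x + 2 * β * f₁ x + β ^ 2 * f x) = u x + x * u' x := by
      linear_combination (u x + x * u' x) * hE
    have k2 : Real.exp (β * x) * (f₁ x + β * f x) = x * u x := by
      linear_combination (x * u x) * hE
    have k3 : Real.exp (β * x) * f x = g x := by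
      linear_combination (g x) * hE
    rw [k1, k2, k3] at key
    have k4 : (x ^ 2 + δ ^ 2) * u' x = Real.exp (β * x) * h x - (2 * lam + 1) * x * u x +
        α ^ 2 * x * g x := by
      simp only [hu', Real.rpow_neg_one]
      field_simp
    refine mul_left_cancel₀ (Real.exp_pos (β * x)).ne' (key.trans ?_)
    have k5 : ((u x + x * u' x) * x - x * u x) / x ^ 2 = u' x := by field_simp; ring
    have k6 : x * u x / x = u x := by field_simp
    rw [k5, k6, k4]
    ring
  have hdecay : ∀ w : ℝ → ℝ, PolyGrowth w → Tendsto (fun x : ℝ => |x| ^ lam *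
      Real.exp (-α * |x| + β * x) * (Real.exp (-β * x) * w x)) (cocompact ℝ) (𝓝 0) :=
    fun w hw => (hw.tendsto_zero lam hα).congr fun x => by
      have : Real.exp (-α * |x|) = Real.exp (-α * |x| + β * x) * Real.exp (-β * x) := by
        rw [← Real.exp_add]; ring_nf
      rw [this]; ring
  have hxu := PolyGrowth.id.mul huG
  have hw1 := hxu.add ((PolyGrowth.const (-β)).mul hgG)
  refine ⟨f, ⟨⟨hcd.of_le (by norm_num), ∅, fun x _ => hcd.contDiffAt, by simp⟩, hcd.contDiffAt,
    ?_, ?_⟩, hstein⟩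
  · have hi : Integrable h (ghMeasure lam α β δ 0) := hc.integrable_of_hasCompactSupport hs
    -- At 0 the operator only has its division-by-zero value, which may differ from h; the point is
    -- null for GH.
    refine hi.congr ((ghMeasure_absolutelyContinuous lam α β δ 0).ae_le ?_)
    filter_upwards [Measure.ae_ne volume (0 : ℝ)] with x hx
    exact (hstein x hx).symm
  · intro j hj
    interval_cases j
    · simpa only [iteratedDeriv_zero] using hdecay g hgG
    · simp only [iteratedDeriv_one, e1]
      exact hdecay _ hw1
    · simp only [iteratedDeriv_succ, iteratedDeriv_zero, e1, e2]
      exact hdecay _ (((huG.add (PolyGrowth.id.mul hu'G)).add ((PolyGrowth.const (-β)).mul hxu)).add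
        ((PolyGrowth.const (-β)).mul hw1))

/-! ### Identification of the law -/

/-- As functionals on compactly supported continuous functions, the kernel of ν lies in that of μ,
so μ is a multiple of ν. Total mass fixes the factor at 1. -/
theorem eq_of_forall_integral_eq_zero {μ ν : Measure ℝ} [IsProbabilityMeasure μ]
    [IsProbabilityMeasure ν]
    (h : ∀ f : ℝ → ℝ, Continuous f → HasCompactSupport f → ∫ x, f x ∂ν = 0 → ∫ x, f x ∂μ = 0) :
    μ = ν := by
  obtain ⟨b, hbc, hbs, hb0, hbν⟩ : ∃ b : ℝ → ℝ, Continuous b ∧ HasCompactSupport b ∧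
      (∀ x, 0 ≤ b x) ∧ ∫ x, b x ∂ν ≠ 0 := by
    by_contra hcon
    -- If every nonnegative b had zero integral, splitting into positive and negative parts would
    -- give ν = 0.
    push Not at hcon
    have hpos : ∀ f : ℝ → ℝ, Continuous f → HasCompactSupport f → ∫ x, f x ∂ν = 0 := by
      intro f hf hfs
      have h1 := hcon (fun x => max (f x) 0) (by fun_prop)
        (hfs.comp_left (g := fun y => max y 0) (by simp)) (fun x => le_max_right _ _)
      have h2 := hcon (fun x => max (-f x) 0) (by fun_prop)
        (hfs.comp_left (g := fun y => max (-y) 0) (by simp)) (fun x => le_max_right _ _)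
      rw [integral_eq_integral_pos_part_sub_integral_neg_part
        (hf.integrable_of_hasCompactSupport hfs)]
      simp only [Real.coe_toNNReal', h1, h2, sub_zero]
    have : ν = 0 := Measure.ext_of_integral_eq_on_compactlySupported fun f => by
      simpa using hpos f f.continuous f.hasCompactSupport
    exact IsProbabilityMeasure.ne_zero ν this
  set c : ℝ := (∫ x, b x ∂μ) / ∫ x, b x ∂ν with hcdef
  have hc0 : 0 ≤ c := div_nonneg (integral_nonneg hb0) (integral_nonneg hb0)
  have hμ : μ = c.toNNReal • ν := Measure.ext_of_integral_eq_on_compactlySupported fun f => by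
    have hfμ : Integrable f μ := f.continuous.integrable_of_hasCompactSupport f.hasCompactSupport
    have hfν : Integrable f ν := f.continuous.integrable_of_hasCompactSupport f.hasCompactSupport
    have hbμ' : Integrable b μ := hbc.integrable_of_hasCompactSupport hbs
    have hbν' : Integrable b ν := hbc.integrable_of_hasCompactSupport hbs
    -- The multiple of b for which f - d b has ν-integral zero.
    set d : ℝ := (∫ x, f x ∂ν) / ∫ x, b x ∂ν with hd
    have h1 := h (fun x => f x - d * b x) (by fun_prop) (f.hasCompactSupport.sub hbs.mul_left)
      (by rw [integral_sub hfν (hbν'.const_mul d), integral_const_mul, hd, div_mul_cancel₀ _ hbν,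
            sub_self])
    rw [integral_sub hfμ (hbμ'.const_mul d), integral_const_mul, sub_eq_zero] at h1
    rw [integral_smul_nnreal_measure, h1, NNReal.smul_def, Real.coe_toNNReal _ hc0, smul_eq_mul,
      hd, hcdef]
    ring
  have huniv : μ Set.univ = (c.toNNReal • ν) Set.univ := by rw [← hμ]
  rw [Measure.smul_apply, measure_univ, measure_univ, ENNReal.smul_def, smul_eq_mul, mul_one,
    eq_comm, ENNReal.coe_eq_one] at huniv
  rw [hμ, huniv, one_smul]

theorem proposition3p1 (lam α β δ : ℝ) (hδ : 0 < δ) (hαβ : |β| < α)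
    {Ω : Type*} [MeasurableSpace Ω] (P : Measure Ω) [IsProbabilityMeasure P]
    (W : Ω → ℝ) (hW : Measurable W) :
    P.map W = ghMeasure lam α β δ 0 ↔
      (∀ᵐ ω ∂P, W ω ≠ 0) ∧
        ∀ f : ℝ → ℝ, IsGHTestFunction lam α β δ f →
          Integrable (fun ω => ghStein lam α β δ f (W ω)) P ∧
            ∫ ω, ghStein lam α β δ f (W ω) ∂P = 0 := by
  have hprob := ghMeasure_isProbabilityMeasure lam hδ hαβ
  have hmap := Measure.isProbabilityMeasure_map (μ := P) hW.aemeasurable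
  constructor
  · intro hlaw
    refine ⟨?_, fun f hf => ?_⟩
    · refine ae_of_ae_map hW.aemeasurable (p := fun x => x ≠ 0) ?_
      rw [hlaw]
      exact (ghMeasure_absolutelyContinuous lam α β δ 0).ae_le (Measure.ae_ne volume (0 : ℝ))
    · have hi : Integrable (ghStein lam α β δ f) (P.map W) := hlaw ▸ hf.integrable
      refine ⟨hi.comp_measurable hW, ?_⟩
      rw [← integral_map hW.aemeasurable hi.aestronglyMeasurable, hlaw]
      exact integral_ghStein_eq_zero hδ hαβ hf
  · rintro ⟨hne, hstein⟩
    refine eq_of_forall_integral_eq_zero fun h hc hs h0 => ?_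
    obtain ⟨f, hf, hfh⟩ := exists_isGHTestFunction_ghStein_eq lam hδ hαβ hc hs h0
    rw [integral_map hW.aemeasurable hc.aestronglyMeasurable, ← (hstein f hf).2]
    refine integral_congr_ae ?_
    filter_upwards [hne] with ω hω
    exact (hfh _ hω).symm
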